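/- In $SL(2,\mathbb{Z})$ let $$s_1=\begin{pmatrix}1&0\\1&1\end{pmatrix},\qquad s_2=\begin{pmatrix}1&-1\\0&1\end{pmatrix}.$$ For tuples of elements of a group, $(a_1,\dots,a_n)\cdot(b_1,\dots,b_m)$ denotes the concatenation $(a_1,\dots,a_n,b_1,\dots,b_m)$, and $(a_1,\dots,a_n)^m$ denotes the concatenation of $m$ copies of $(a_1,\dots,a_n)$. An elementary transformation of a tuple replaces two adjacent entries $a,b$ by $b,\;b^{-1}ab$, or by $aba^{-1},\;a$. Theorem. Let $k\ge 0$ be an integer and let $(g_1,\dots,g_n)$, $n\ge 0$, be an $n$-tuple of elements of $SL(2,\mathbb{Z})$ each of which is conjugate to $s_1$ in $SL(2,\mathbb{Z})$. (1) If $g_1\cdots g_n=s_1^k$, then $n-k=12p$ for some integer $p\ge 0$, and $(g_1,\dots,g_n)$ can be changed to $(s_1,s_2)^{6p}\cdot(s_1)^k$ by a finite sequence of elementary transformations. (2) If $g_1\cdots g_n=(s_1s_2)^3s_1^k$, then $n-6-k=12p$ for some integer $p\ge 0$, and $(g_1,\dots,g_n)$ can be changed to $(s_1,s_2)^{6p+3}\cdot(s_1)^k$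 by a finite sequence of elementary transformations. -/

import Mathlib

open scoped MatrixGroups

/-- The matrix `s₁`, image of the positive Dehn twist along the first generator of `π₁(T²)`. -/
def s₁ : SL(2, ℤ) := ⟨!![1, 0; 1, 1], by simp [Matrix.det_fin_two_of]⟩

/-- The matrix `s₂`, image of the positive Dehn twist along the second generator of `π₁(T²)`. -/
def s₂ : SL(2, ℤ) := ⟨!![1, -1; 0, 1], by simp [Matrix.det_fin_two_of]⟩

/-- One elementary transformation (Hurwitz move) of a tuple of elements of a group: two adjacent
entries `a, b` are replaced by `b, b⁻¹ a b`, or, inversely, by `a b a⁻¹, a`. -/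
inductive ElementaryTransformation {G : Type*} [Group G] : List G → List G → Prop
  | right (u v : List G) (a b : G) :
      ElementaryTransformation (u ++ [a, b] ++ v) (u ++ [b, b⁻¹ * a * b] ++ v)
  | left (u v : List G) (a b : G) :
      ElementaryTransformation (u ++ [a, b] ++ v) (u ++ [a * b * a⁻¹, a] ++ v)

/-- Hurwitz equivalence: the first tuple can be changed to the second one by a finite (possibly
empty) sequence of elementary transformations. The two kinds of moves are inverse to each other,
so this is an equivalence relation. -/
def HurwitzEquivalent {G : Type*} [Group G] : List G → List G → Prop :=
  Relation.ReflTransGen ElementaryTransformation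

/-- The tuple `(a₁, …, aₙ)^m`: the concatenation of `m` copies of `(a₁, …, aₙ)`. -/
def tuplePow {G : Type*} (a : List G) (m : ℕ) : List G :=
  (List.replicate m a).flatten

/-! Modulo sign, SL(2,ℤ) is generated by δ = `delta` (order three) and b = `quarter` (order two),
with `s₁` = ±δ²b. Conjugates of `s₁` are indexed by words in δ and b; the depth counts the letters b
in the conjugating word. The group acts on lines through first columns. The translates of a base
cone form a tree of cones, and each conjugate maps the complement of its repelling cone into its
attracting cone.

For an adjacent pair with overlapping cones (`reduce_of_not_separated`), either a Hurwitz move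
lowers the total depth, or the pair has product δ and is equivalent to `[s₁, s₂]`. In the latter
case it is moved to the front and split off, leaving a shorter tuple with product again of the form
δ^e s₁^k. If no adjacent cones overlap, ping-pong determines the tuple from its product δ^e s₁^k: it
is k copies of `s₁` (`map_val_eq_replicate_of_separated`). Induction on length, then on depth, gives
(s₁,s₂)^m (s₁)^k; since δ has order six, the product fixes m modulo 6, and lengths give n = 2m + k.
-/

/-- The product `s₁ s₂`, of order six. -/
def delta : SL(2, ℤ) := s₁ * s₂

/-- The matrix of order four that swaps the two sides of the base edge. -/
def quarter : SL(2, ℤ) := ModularGroup.S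

lemma delta_pow_three : delta ^ 3 = -1 := by decide

lemma delta_pow_six : delta ^ 6 = 1 := by decide

lemma quarter_mul_quarter : quarter * quarter = -1 := by decide

lemma quarter_inv : quarter⁻¹ = -quarter := by decide

lemma s₁_eq : s₁ = -(delta ^ 2 * quarter) := by decide

/-- The powers `1, δ, δ²`, indexed modulo three. -/
def deltaPow (j : Fin 3) : SL(2, ℤ) := delta ^ (j : ℕ)

/-- The exponent coded by a Boolean letter. -/
def letterExp (t : Bool) : Fin 3 := if t then 2 else 1

/-- The matrix of a reduced word with syllables `b δ` and `b δ²`. -/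
def wordMat (W : List Bool) : SL(2, ℤ) := (W.map fun t => quarter * deltaPow (letterExp t)).prod

@[simp] lemma wordMat_nil : wordMat [] = 1 := rfl

@[simp] lemma wordMat_cons (t : Bool) (W : List Bool) :
    wordMat (t :: W) = quarter * deltaPow (letterExp t) * wordMat W := by
  simp [wordMat]

@[simp] lemma wordMat_append (V W : List Bool) :
    wordMat (V ++ W) = wordMat V * wordMat W := by
  simp [wordMat]

/-! ### Word length in the generators δ and b -/

/-- `WordLength m x`: the matrix `x` is a word in `δ` and `b` with `m` letters `b`. -/
inductive WordLength : ℕ → SL(2, ℤ) → Prop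
  | one : WordLength 0 1
  | delta_mul {m x} : WordLength m x → WordLength m (delta * x)
  | quarter_mul {m x} : WordLength m x → WordLength (m + 1) (quarter * x)

namespace WordLength

lemma mul {m n : ℕ} {x y : SL(2, ℤ)} (hx : WordLength m x) (hy : WordLength n y) :
    WordLength (m + n) (x * y) := by
  induction hx with
  | one => simpa using hy
  | delta_mul _ ih => rw [mul_assoc]; exact ih.delta_mul
  | @quarter_mul m x _ ih =>
    rw [mul_assoc, Nat.add_right_comm]; exact ih.quarter_mul

lemma of_delta_pow (e : ℕ) : WordLength 0 (delta ^ e) := by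
  induction e with
  | zero => simpa using one
  | succ e ih => rw [pow_succ']; exact ih.delta_mul

lemma neg {m : ℕ} {x : SL(2, ℤ)} (hx : WordLength m x) : WordLength m (-x) := by
  have h := (of_delta_pow 3).mul hx
  rwa [delta_pow_three, neg_one_mul, zero_add] at h

lemma of_quarter : WordLength 1 quarter := by
  simpa using one.quarter_mul

lemma of_deltaPow (j : Fin 3) : WordLength 0 (deltaPow j) := of_delta_pow _

lemma of_wordMat (W : List Bool) : WordLength W.length (wordMat W) := by
  induction W with
  | nil => exact one
  | cons t W ih =>
    rw [wordMat_cons, mul_assoc]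
    simpa using ((of_deltaPow _).mul ih).quarter_mul

/-- The outer left b cancels, up to sign, against the leading b of the word, so the flanking pair
costs nothing. This is the source of every strict drop in depth. -/
lemma quarter_wordMat_quarter (W : List Bool) :
    WordLength W.length (quarter * wordMat W * quarter) := by
  cases W with
  | nil =>
    rw [wordMat_nil, mul_one, quarter_mul_quarter]
    exact one.neg
  | cons t W =>
    have h : quarter * wordMat (t :: W) * quarter
        = -(deltaPow (letterExp t) * wordMat W * quarter) := by
      rw [wordMat_cons]
      simp only [← mul_assoc, quarter_mul_quarter, neg_mul, one_mul]
    rw [h]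
    simpa using (((of_deltaPow _).mul (of_wordMat W)).mul of_quarter).neg

lemma inv {m : ℕ} {x : SL(2, ℤ)} (hx : WordLength m x) : WordLength m x⁻¹ := by
  induction hx with
  | one => simpa using one
  | delta_mul _ ih =>
    have h : delta⁻¹ = delta ^ 5 := by decide
    rw [mul_inv_rev, h]
    simpa using ih.mul (of_delta_pow 5)
  | quarter_mul _ ih =>
    rw [mul_inv_rev, quarter_inv]
    exact ih.mul of_quarter.neg

lemma exists_wordLength (x : SL(2, ℤ)) : ∃ m, WordLength m x := by
  have hx : x ∈ Subgroup.closure {ModularGroup.S, ModularGroup.T} := by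
    rw [SpecialLinearGroup.SL2Z_generators]; trivial
  induction hx using Subgroup.closure_induction with
  | mem y hy =>
    rcases hy with rfl | rfl
    · exact ⟨1, of_quarter⟩
    · have h : ModularGroup.T = delta ^ 4 * quarter := by decide
      rw [h]
      exact ⟨_, (of_delta_pow 4).mul of_quarter⟩
  | one => exact ⟨0, one⟩
  | mul y z _ _ hy hz =>
    obtain ⟨m, hm⟩ := hy
    obtain ⟨n, hn⟩ := hz
    exact ⟨_, hm.mul hn⟩
  | inv y _ hy =>
    obtain ⟨m, hm⟩ := hy
    exact ⟨m, hm.inv⟩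

end WordLength

/-! ### Normal forms of conjugates -/

/-- Normal forms of the conjugates of `s₁`, up to the choice of a conjugating matrix. -/
inductive ConjForm
  | short (j : Fin 3)
  | long (j : Fin 3) (W : List Bool)

namespace ConjForm

/-- The conjugating matrix of a normal form. -/
def rep : ConjForm → SL(2, ℤ)
  | short j => deltaPow j
  | long j W => deltaPow j * wordMat W * quarter * delta ^ 2

/-- The conjugate of `s₁` with a given normal form. -/
def val (d : ConjForm) : SL(2, ℤ) := d.rep * s₁ * d.rep⁻¹

/-- The number of letters `b` in the conjugating matrix. -/
def depth : ConjForm → ℕ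
  | short _ => 0
  | long _ W => W.length + 1

lemma wordLength_rep (d : ConjForm) : WordLength d.depth d.rep := by
  cases d with
  | short j => exact .of_deltaPow j
  | long j W =>
    simpa [rep, depth] using
      (((WordLength.of_deltaPow j).mul (.of_wordMat W)).mul .of_quarter).mul (.of_delta_pow 2)

end ConjForm

lemma conj_eq_of_eq_or_neg {x y : SL(2, ℤ)} (h : x = y ∨ x = -y) (g : SL(2, ℤ)) :
    x * g * x⁻¹ = y * g * y⁻¹ := by
  rcases h with rfl | rfl
  · rfl
  · simp [inv_neg]

lemma delta_mul_deltaPow (j : Fin 3) :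
    deltaPow (j + 1) = delta * deltaPow j ∨ deltaPow (j + 1) = -(delta * deltaPow j) := by
  revert j; decide

namespace ConjForm

/-- The action of `δ` by conjugation on normal forms. -/
def rotate : ConjForm → ConjForm
  | short j => short (j + 1)
  | long j W => long (j + 1) W

lemma val_rotate (d : ConjForm) : d.rotate.val = delta * d.val * delta⁻¹ := by
  have h : d.rotate.rep = delta * d.rep ∨ d.rotate.rep = -(delta * d.rep) := by
    cases d with
    | short j => exact delta_mul_deltaPow j
    | long j W =>
      rcases delta_mul_deltaPow j with h | h
      · left; simp only [rotate, rep, h, mul_assoc]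
      · right; simp only [rotate, rep, h, mul_assoc, neg_mul]
  rw [val, conj_eq_of_eq_or_neg h, val]
  group

lemma depth_rotate (d : ConjForm) : d.rotate.depth = d.depth := by
  cases d <;> rfl

lemma exists_quarter_conj (d : ConjForm) :
    ∃ d' : ConjForm, d'.val = quarter * d.val * quarter⁻¹ ∧ d'.depth ≤ d.depth + 1 := by
  have key : ∀ d' : ConjForm, (d'.rep = quarter * d.rep ∨ d'.rep = -(quarter * d.rep)) →
      d'.val = quarter * d.val * quarter⁻¹ := by
    intro d' h
    rw [val, conj_eq_of_eq_or_neg h, val]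
    group
  cases d with
  | short j =>
    -- The forms 0 and 1 are exchanged because b s₁ b⁻¹ = δ⁻² s₁ δ², with δ⁻² = -δ; only j = 2 gains
    -- a letter.
    fin_cases j
    · exact ⟨short 1, by decide, by simp [depth]⟩
    · exact ⟨short 0, by decide, by simp [depth]⟩
    · exact ⟨long 0 [], by decide, by simp [depth]⟩
  | long j W =>
    by_cases hj : j = 0
    · subst hj
      cases W with
      | nil => exact ⟨short 2, by decide, by simp [depth]⟩
      | cons t W =>
        refine ⟨long (letterExp t) W, key _ (Or.inr ?_), by simp [depth]⟩
        simp only [rep, wordMat_cons]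
        have h0 : deltaPow 0 = 1 := rfl
        simp only [h0, one_mul, ← mul_assoc, quarter_mul_quarter, neg_mul, neg_neg]
    · obtain ⟨t, rfl⟩ : ∃ t, j = letterExp t := by clear key; revert j; decide
      refine ⟨long 0 (t :: W), key _ (Or.inl ?_), by simp [depth]⟩
      have h0 : deltaPow 0 = 1 := rfl
      simp only [rep, wordMat_cons, h0, one_mul, mul_assoc]

lemma exists_of_wordLength {m : ℕ} {x : SL(2, ℤ)} (hx : WordLength m x) :
    ∃ d : ConjForm, d.val = x * s₁ * x⁻¹ ∧ d.depth ≤ m := by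
  induction hx with
  | one => exact ⟨short 0, by decide, le_rfl⟩
  | delta_mul _ ih =>
    obtain ⟨d, hd, hm⟩ := ih
    exact ⟨d.rotate, by rw [val_rotate, hd]; group, by rwa [depth_rotate]⟩
  | quarter_mul _ ih =>
    obtain ⟨d, hd, hm⟩ := ih
    obtain ⟨d', hd', hm'⟩ := d.exists_quarter_conj
    exact ⟨d', by rw [hd', hd]; group, by lia⟩

lemma exists_of_isConj {g : SL(2, ℤ)} (hg : IsConj s₁ g) : ∃ d : ConjForm, d.val = g := by
  obtain ⟨x, rfl⟩ := isConj_iff.1 hg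
  obtain ⟨m, hm⟩ := WordLength.exists_wordLength x
  obtain ⟨d, hd, -⟩ := exists_of_wordLength hm
  exact ⟨d, hd⟩

end ConjForm

/-! ### The tree of cones -/

/-- The first column of `x` spans a line of slope in `[-∞, 0]`, the vertical line excluded. -/
def InBaseCone (x : SL(2, ℤ)) : Prop :=
  x 1 0 = 0 ∨ (x 0 0 < 0 ∧ 0 < x 1 0) ∨ (0 < x 0 0 ∧ x 1 0 < 0)

lemma inBaseCone_neg {x : SL(2, ℤ)} : InBaseCone (-x) ↔ InBaseCone x := by
  simp only [InBaseCone, Matrix.SpecialLinearGroup.coe_neg, Matrix.neg_apply]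
  omega

lemma mul_apply_zero (g x : SL(2, ℤ)) (i : Fin 2) :
    (g * x) i 0 = g i 0 * x 0 0 + g i 1 * x 1 0 := by
  simp [Matrix.SpecialLinearGroup.coe_mul, Matrix.mul_apply, Fin.sum_univ_two]

lemma first_column_ne_zero (x : SL(2, ℤ)) : x 0 0 ≠ 0 ∨ x 1 0 ≠ 0 := by
  by_contra! h
  have := x.det_coe
  rw [Matrix.det_fin_two, h.1, h.2] at this
  simp at this

lemma inBaseCone_quarter_inv_mul {x : SL(2, ℤ)} :
    InBaseCone (quarter⁻¹ * x) ↔ ¬ InBaseCone x := by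
  have h := first_column_ne_zero x
  have h00 : quarter⁻¹ 0 0 = 0 := by decide
  have h01 : quarter⁻¹ 0 1 = 1 := by decide
  have h10 : quarter⁻¹ 1 0 = -1 := by decide
  have h11 : quarter⁻¹ 1 1 = 0 := by decide
  simp only [InBaseCone, mul_apply_zero, h00, h01, h10, h11]
  omega

lemma eq_of_inBaseCone {i j : Fin 3} {x : SL(2, ℤ)} (hi : InBaseCone ((deltaPow i)⁻¹ * x))
    (hj : InBaseCone ((deltaPow j)⁻¹ * x)) : i = j := by
  have h := first_column_ne_zero x
  have h0 : (deltaPow 0)⁻¹ 0 0 = 1 ∧ (deltaPow 0)⁻¹ 0 1 = 0 ∧ (deltaPow 0)⁻¹ 1 0 = 0 ∧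
    (deltaPow 0)⁻¹ 1 1 = 1 := by decide
  have h1 : (deltaPow 1)⁻¹ 0 0 = 0 ∧ (deltaPow 1)⁻¹ 0 1 = 1 ∧ (deltaPow 1)⁻¹ 1 0 = -1 ∧
    (deltaPow 1)⁻¹ 1 1 = 1 := by decide
  have h2 : (deltaPow 2)⁻¹ 0 0 = -1 ∧ (deltaPow 2)⁻¹ 0 1 = 1 ∧ (deltaPow 2)⁻¹ 1 0 = -1 ∧
    (deltaPow 2)⁻¹ 1 1 = 0 := by decide
  fin_cases i <;> fin_cases j <;> first
    | rfl
    | (exfalso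
       simp only [Fin.zero_eta, Fin.mk_one, Fin.reduceFinMk, InBaseCone, mul_apply_zero, h0, h1,
         h2] at hi hj
       omega)

/-- The matrix carrying the base cone to the cone indexed by `(j, W)`. -/
def nodeMat (n : Fin 3 × List Bool) : SL(2, ℤ) := deltaPow n.1 * wordMat n.2

/-- Membership of the first column of `x` in the cone indexed by `n`. -/
def InCone (n : Fin 3 × List Bool) (x : SL(2, ℤ)) : Prop := InBaseCone ((nodeMat n)⁻¹ * x)

lemma inCone_iff_of_eq_or_neg {n : Fin 3 × List Bool} {y : SL(2, ℤ)}
    (h : nodeMat n = y ∨ nodeMat n = -y) (x : SL(2, ℤ)) : InCone n x ↔ InBaseCone (y⁻¹ * x) := by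
  rcases h with h | h
  · rw [InCone, h]
  · rw [InCone, h, inv_neg, neg_mul, inBaseCone_neg]

lemma inCone_nil {j : Fin 3} {x : SL(2, ℤ)} :
    InCone (j, []) x ↔ InBaseCone ((deltaPow j)⁻¹ * x) := by
  simp [InCone, nodeMat]

lemma inCone_cons {j : Fin 3} {t : Bool} {W : List Bool} {x : SL(2, ℤ)} :
    InCone (j, t :: W) x ↔ InCone (letterExp t, W) (quarter⁻¹ * ((deltaPow j)⁻¹ * x)) := by
  simp only [InCone, nodeMat, wordMat_cons, mul_inv_rev, mul_assoc]

lemma inBaseCone_of_inCone_letterExp {t : Bool} {z : SL(2, ℤ)}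
    (h : InCone (letterExp t, []) (quarter⁻¹ * z)) : InBaseCone z := by
  by_contra hz
  rw [← inBaseCone_quarter_inv_mul] at hz
  have h0 : InBaseCone ((deltaPow 0)⁻¹ * (quarter⁻¹ * z)) := by
    have : deltaPow 0 = 1 := rfl
    simpa [this] using hz
  have := eq_of_inBaseCone (inCone_nil.1 h) h0
  revert this; cases t <;> decide

lemma InCone.root {j : Fin 3} {W : List Bool} {x : SL(2, ℤ)} (h : InCone (j, W) x) :
    InCone (j, []) x := by
  induction W generalizing j x with
  | nil => exact h
  | cons t W ih =>
    rw [inCone_nil]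
    exact inBaseCone_of_inCone_letterExp (ih (inCone_cons.1 h))

/-- The three root cones are pairwise disjoint, and stripping one letter transports the claim to
shorter words. Hence two cones meet only when one index extends the other. -/
lemma InCone.comparable {i j : Fin 3} {V W : List Bool} {x : SL(2, ℤ)} (hV : InCone (i, V) x)
    (hW : InCone (j, W) x) : i = j ∧ (V <+: W ∨ W <+: V) := by
  induction V generalizing i j W x with
  | nil => exact ⟨eq_of_inBaseCone (inCone_nil.1 hV) (inCone_nil.1 hW.root), .inl List.nil_prefix⟩
  | cons t V ih =>
    obtain rfl := eq_of_inBaseCone (inCone_nil.1 hV.root) (inCone_nil.1 hW.root)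
    refine ⟨rfl, ?_⟩
    cases W with
    | nil => exact .inr List.nil_prefix
    | cons u W =>
      obtain ⟨htu, h⟩ := ih (inCone_cons.1 hV) (inCone_cons.1 hW)
      have : t = u := by revert htu; cases t <;> cases u <;> decide
      subst this
      simpa using h

/-! ### Attracting and repelling cones, and depth reduction -/

namespace ConjForm

/-- The cone into which a conjugate of `s₁` maps the complement of its repelling cone. -/
def attracting : ConjForm → Fin 3 × List Bool
  | short j => (j + 2, [])
  | long j W => (j, W ++ [false])

/-- The cone whose complement is mapped into the attracting cone. -/
def repelling : ConjForm → Fin 3 × List Bool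
  | short j => (j, [])
  | long j W => (j, W ++ [true])

lemma nodeMat_repelling (d : ConjForm) : nodeMat d.repelling = d.rep := by
  cases d with
  | short j => simp [nodeMat, repelling, rep]
  | long j W =>
    have : deltaPow (letterExp true) = delta ^ 2 := rfl
    simp [nodeMat, repelling, rep, this, mul_assoc]

lemma nodeMat_attracting (d : ConjForm) :
    nodeMat d.attracting = d.rep * delta ^ 2 ∨ nodeMat d.attracting = -(d.rep * delta ^ 2) := by
  cases d with
  | short j =>
    simp only [nodeMat, attracting, rep, wordMat_nil, mul_one]
    revert j; decide
  | long j W =>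
    right
    have : deltaPow (letterExp false) = -(delta ^ 2 * delta ^ 2) := by decide
    simp [nodeMat, attracting, rep, this, mul_assoc]

/-- After conjugating by `rep`, this is `s₁` = δ² b⁻¹: b⁻¹ sends the complement of the base cone
into the base cone, and δ² moves that to the attracting cone. -/
lemma inCone_attracting {d : ConjForm} {x : SL(2, ℤ)} (h : ¬ InCone d.repelling x) :
    InCone d.attracting (d.val * x) := by
  rw [inCone_iff_of_eq_or_neg d.nodeMat_attracting]
  rw [inCone_iff_of_eq_or_neg (.inl d.nodeMat_repelling), ← inBaseCone_quarter_inv_mul] at h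
  have key : (delta ^ 2)⁻¹ * s₁ = quarter⁻¹ := by decide
  have : (d.rep * delta ^ 2)⁻¹ * (d.val * x) = (delta ^ 2)⁻¹ * s₁ * (d.rep⁻¹ * x) := by
    rw [val]; group
  rwa [this, key]

/-- When the conjugating word of `d'` extends that of `d`, inserting `s₁` = -δ²b between the two
pieces produces b U b, which cancels a letter. -/
lemma exists_conj_depth_lt {d d' : ConjForm} {U : List Bool}
    (h : d'.rep = d.rep * (wordMat U * quarter * delta ^ 2))
    (hd : d'.depth = d.depth + U.length + 1) :
    ∃ d'' : ConjForm, d''.val = d.val * d'.val * d.val⁻¹ ∧ d''.depth < d'.depth := by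
  have hw : WordLength (d.depth + U.length) (d.val * d'.rep) := by
    have : d.val * d'.rep
        = -(d.rep * (delta ^ 2 * ((quarter * wordMat U * quarter) * delta ^ 2))) := by
      rw [val, h, s₁_eq]
      simp only [mul_neg, neg_mul, mul_assoc, inv_mul_cancel_left]
    rw [this]
    simpa using ((d.wordLength_rep).mul ((WordLength.of_delta_pow 2).mul
      ((WordLength.quarter_wordMat_quarter U).mul (.of_delta_pow 2)))).neg
  obtain ⟨d'', hv, hl⟩ := exists_of_wordLength hw
  refine ⟨d'', ?_, by lia⟩
  have hd' : d'.val = d'.rep * s₁ * d'.rep⁻¹ := rfl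
  rw [hv, hd']
  group

lemma exists_inv_conj_depth_lt {d d' : ConjForm} {U : List Bool}
    (h : d.rep = d'.rep * delta ^ 2 * (wordMat U * quarter * delta ^ 2) ∨
      d.rep = -(d'.rep * delta ^ 2 * (wordMat U * quarter * delta ^ 2)))
    (hd : d.depth = d'.depth + U.length + 1) :
    ∃ d'' : ConjForm, d''.val = d'.val⁻¹ * d.val * d'.val ∧ d''.depth < d.depth := by
  have hs : s₁⁻¹ * delta ^ 2 = quarter := by decide
  have hw : WordLength (d'.depth + U.length)
      (d'.rep * ((quarter * wordMat U * quarter) * delta ^ 2)) := by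
    simpa using (d'.wordLength_rep).mul ((WordLength.quarter_wordMat_quarter U).mul (.of_delta_pow 2))
  obtain ⟨d'', hv, hl⟩ := exists_of_wordLength hw
  refine ⟨d'', ?_, by lia⟩
  have hd' : d.val = d.rep * s₁ * d.rep⁻¹ := rfl
  have key : d'.rep * ((quarter * wordMat U * quarter) * delta ^ 2)
      = d'.val⁻¹ * (d'.rep * delta ^ 2 * (wordMat U * quarter * delta ^ 2)) := by
    nth_rewrite 1 [← hs]
    rw [val]; group
  rw [hv, key, hd', conj_eq_of_eq_or_neg h]
  group

/-- The attracting cone of the second form is disjoint from the repelling cone of the first. -/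
def Separated (d d' : ConjForm) : Prop := ∀ x, InCone d'.attracting x → ¬ InCone d.repelling x

lemma reduce_of_not_separated {d d' : ConjForm} (h : ¬ Separated d d') :
    (∃ j, d = short j ∧ d' = short (j + 1)) ∨
    (∃ d'' : ConjForm, d''.val = d.val * d'.val * d.val⁻¹ ∧ d''.depth < d'.depth) ∨
    (∃ d'' : ConjForm, d''.val = d'.val⁻¹ * d.val * d'.val ∧ d''.depth < d.depth) := by
  simp only [Separated, not_forall, not_not] at h
  obtain ⟨x, ha, hr⟩ := h
  cases d with
  | short i =>
    cases d' with
    | short j =>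
      obtain ⟨h, -⟩ := ha.comparable hr
      exact .inl ⟨i, rfl, by rw [show j = i + 1 by clear ha hr; revert h; revert i j; decide]⟩
    | long j W =>
      obtain ⟨rfl, -⟩ := ha.comparable hr
      exact .inr (.inl (exists_conj_depth_lt (U := W) (by simp only [rep, mul_assoc])
        (by simp [depth])))
  | long i V =>
    have rep_eq : ∀ {d : ConjForm} {j : Fin 3} {W U : List Bool}, d.attracting = (j, W) →
        V = W ++ U → i = j →
        (long i V).rep = d.rep * delta ^ 2 * (wordMat U * quarter * delta ^ 2) ∨
        (long i V).rep = -(d.rep * delta ^ 2 * (wordMat U * quarter * delta ^ 2)) := by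
      rintro d j W U hd rfl rfl
      have h : (long i (W ++ U)).rep
          = nodeMat d.attracting * (wordMat U * quarter * delta ^ 2) := by
        simp only [hd, rep, nodeMat, wordMat_append, mul_assoc]
      rw [h]
      rcases d.nodeMat_attracting with h | h
      · left; rw [h]
      · right; rw [h, neg_mul]
    cases d' with
    | short j =>
      obtain ⟨h, -⟩ := ha.comparable hr
      exact .inr (.inr (exists_inv_conj_depth_lt (rep_eq rfl (List.nil_append V).symm h.symm)
        (by simp [depth])))
    | long j W =>
      obtain ⟨rfl, h | h⟩ := ha.comparable hr
      -- The words end in `false` and `true`, so they differ and the prefix is proper.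
      · rw [List.prefix_concat_iff] at h
        obtain h | ⟨U, rfl⟩ := h
        · simp at h
        · exact .inr (.inr (exists_inv_conj_depth_lt (rep_eq (U := U) rfl rfl rfl)
            (by simp [depth]; lia)))
      · rw [List.prefix_concat_iff] at h
        obtain h | ⟨U, rfl⟩ := h
        · simp at h
        · refine .inr (.inl (exists_conj_depth_lt (U := U) ?_ (by simp [depth]; lia)))
          have : deltaPow (letterExp true) = delta ^ 2 := rfl
          simp [rep, this, mul_assoc]

end ConjForm

/-! ### Ping-pong for separated tuples -/

namespace ConjForm

lemma inCone_attracting_prod {d d' : ConjForm} {l : List ConjForm}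
    (hl : (d :: l).IsChain Separated) (hd' : (d :: l).getLast? = some d') {x : SL(2, ℤ)}
    (hx : ¬ InCone d'.repelling x) :
    InCone d.attracting (((d :: l).map val).prod * x) := by
  induction l generalizing d with
  | nil =>
    obtain rfl : d = d' := by simpa using hd'
    simpa using inCone_attracting hx
  | cons c l ih =>
    rw [List.isChain_cons_cons] at hl
    have h := ih hl.2 (by simpa using hd')
    rw [List.map_cons, List.prod_cons, mul_assoc]
    exact inCone_attracting (hl.1 _ h)

end ConjForm

lemma inCone_delta_mul {j : Fin 3} {W : List Bool} {x : SL(2, ℤ)} (h : InCone (j, W) x) :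
    InCone (j + 1, W) (delta * x) := by
  have hn : nodeMat (j + 1, W) = delta * nodeMat (j, W) ∨
      nodeMat (j + 1, W) = -(delta * nodeMat (j, W)) := by
    rcases delta_mul_deltaPow j with h | h
    · left; simp only [nodeMat, h, mul_assoc]
    · right; simp only [nodeMat, h, mul_assoc, neg_mul]
  rw [inCone_iff_of_eq_or_neg hn]
  have : (delta * nodeMat (j, W))⁻¹ * (delta * x) = (nodeMat (j, W))⁻¹ * x := by group
  rwa [this]

lemma inCone_delta_pow_mul (e : ℕ) {j : Fin 3} {W : List Bool} {x : SL(2, ℤ)}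
    (h : InCone (j, W) x) : InCone (j + Fin.ofNat 3 e, W) (delta ^ e * x) := by
  induction e with
  | zero => simpa using h
  | succ e ih =>
    have h1 := inCone_delta_mul ih
    have h2 : Fin.ofNat 3 (e + 1) = Fin.ofNat 3 e + 1 := by
      ext; simp [Fin.ofNat, Fin.val_add]
    rw [h2, ← add_assoc, pow_succ', mul_assoc]
    exact h1

lemma inCone_deltaPow (j : Fin 3) : InCone (j, []) (deltaPow j) := by
  rw [inCone_nil, inv_mul_cancel]
  exact .inl (by decide)

lemma inCone_s₁_pow (m : ℕ) :
    InCone (2, List.replicate m true) (s₁ ^ m * deltaPow 2) := by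
  have h : s₁ ^ m * deltaPow 2 = deltaPow 2 * wordMat (List.replicate m true) ∨
      s₁ ^ m * deltaPow 2 = -(deltaPow 2 * wordMat (List.replicate m true)) := by
    induction m with
    | zero => left; simp
    | succ m ih =>
      have h1 : s₁ * deltaPow 2 = -(deltaPow 2 * (quarter * deltaPow (letterExp true))) := by decide
      rw [pow_succ', mul_assoc, List.replicate_succ, wordMat_cons]
      rcases ih with h | h
      · right
        rw [h, ← mul_assoc, h1]; simp only [neg_mul, mul_assoc]
      · left
        rw [h, mul_neg, ← mul_assoc, h1]; simp only [neg_mul, mul_assoc, neg_neg]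
  have h0 : InBaseCone 1 := .inl (by decide)
  rw [InCone, nodeMat]
  rcases h with h | h
  · rwa [h, inv_mul_cancel]
  · rwa [h, mul_neg, inv_mul_cancel, inBaseCone_neg]

lemma inCone_s₁_inv_pow_mul {m : ℕ} {j : Fin 3} (hj : j ≠ 2) :
    InCone (0, []) ((s₁ ^ (m + 1))⁻¹ * deltaPow j) := by
  have step : ∀ x, ¬ InCone (2, []) x → InCone (0, []) (s₁⁻¹ * x) := by
    intro x hx
    by_contra h
    apply hx
    have := ConjForm.inCone_attracting (d := .short 0) h
    have hv : (ConjForm.short 0).val = s₁ := by decide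
    rwa [hv, mul_inv_cancel_left] at this
  induction m with
  | zero =>
    rw [zero_add, pow_one]
    exact step _ fun h => hj ((inCone_deltaPow j).comparable h).1
  | succ m ih =>
    rw [pow_succ, mul_inv_rev, mul_assoc]
    exact step _ fun h => absurd (ih.comparable h).1 (by decide)

lemma s₁_pow (k : ℕ) : (s₁ ^ k : SL(2, ℤ)) 1 0 = k ∧ (s₁ ^ k : SL(2, ℤ)) 0 0 = 1 := by
  induction k with
  | zero => decide
  | succ k ih =>
    have h0 : s₁ 0 0 = 1 ∧ s₁ 0 1 = 0 ∧ s₁ 1 0 = 1 ∧ s₁ 1 1 = 1 := by decide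
    rw [pow_succ', mul_apply_zero, mul_apply_zero]
    simp only [h0, ih]
    push_cast
    constructor <;> ring

lemma delta_pow_mul_s₁_pow_ne_one {e k : ℕ} (h : delta ^ e * s₁ ^ k = 1) : k = 0 := by
  have h1 : s₁ ^ k = (delta ^ e)⁻¹ := eq_inv_of_mul_eq_one_right h
  have h2 : (s₁ ^ (k * 6) : SL(2, ℤ)) = 1 := by
    rw [pow_mul, h1, inv_pow, ← pow_mul, mul_comm e, pow_mul, delta_pow_six, one_pow, inv_one]
  have h3 := (s₁_pow (k * 6)).1
  rw [h2] at h3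
  have h4 : (1 : SL(2, ℤ)) 1 0 = 0 := by decide
  rw [h4] at h3
  push_cast at h3
  lia

namespace ConjForm

lemma val_short_ofNat (e : ℕ) : (short (Fin.ofNat 3 e)).val = delta ^ e * s₁ * (delta ^ e)⁻¹ := by
  induction e with
  | zero => decide
  | succ e ih =>
    have h2 : short (Fin.ofNat 3 (e + 1)) = (short (Fin.ofNat 3 e)).rotate := by
      rw [rotate]; congr 1; ext; simp [Fin.ofNat, Fin.val_add]
    rw [h2, val_rotate, ih, pow_succ']
    group

/-- The first member of a separated tuple with product `δ^e s₁^k` is short. -/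
lemma head_eq_of_prod_eq {d : ConjForm} {l : List ConjForm} (hl : (d :: l).IsChain Separated)
    {e k : ℕ} (hp : ((d :: l).map val).prod = delta ^ e * s₁ ^ k) :
    d = short (Fin.ofNat 3 e) ∧ k ≠ 0 := by
  obtain ⟨d', hd'⟩ : ∃ d', (d :: l).getLast? = some d' := ⟨_, List.getLast?_cons⟩
  have main : ∀ x, ¬ InCone d'.repelling x → InCone d.attracting (delta ^ e * (s₁ ^ k * x)) := by
    intro x hx
    have := inCone_attracting_prod hl hd' hx
    rwa [hp, mul_assoc] at this
  -- Everything outside the last repelling cone ends in one attracting cone, hence in a single root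
  -- cone.
  have collide : ∀ {i j x y}, InCone (i, []) (s₁ ^ k * x) → InCone (j, []) (s₁ ^ k * y) →
      ¬ InCone d'.repelling x → ¬ InCone d'.repelling y → i = j := by
    intro i j x y hi hj hx hy
    have h1 := ((inCone_delta_pow_mul e hi).comparable (main x hx)).1
    have h2 := ((inCone_delta_pow_mul e hj).comparable (main y hy)).1
    exact add_right_cancel (h1.trans h2.symm)
  -- For k = 0 the product permutes the three root cones, at least two of which avoid the last
  -- repelling cone.
  have hk : k ≠ 0 := by
    rintro rfl
    have aux : ∀ i, InCone (i, []) (s₁ ^ 0 * deltaPow i) := by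
      intro i; simpa using inCone_deltaPow i
    have rep : ∀ i, i ≠ d'.repelling.1 → ¬ InCone d'.repelling (deltaPow i) :=
      fun i hi h => hi ((inCone_deltaPow i).comparable h).1
    have h1 := collide (aux (d'.repelling.1 + 1)) (aux (d'.repelling.1 + 2))
      (rep _ (by generalize d'.repelling.1 = i; revert i; decide))
      (rep _ (by generalize d'.repelling.1 = i; revert i; decide))
    revert h1; generalize d'.repelling.1 = i; revert i; decide
  refine ⟨?_, hk⟩
  obtain ⟨m, rfl⟩ := Nat.exists_eq_succ_of_ne_zero hk
  -- Otherwise the preimages under s₁^(m+1) of columns in root cones 0 and 1, both lying in root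
  -- cone 0, would avoid the repelling cone and then collide.
  have hlast : d'.repelling.1 = 0 := by
    by_contra h0
    have aux : ∀ i, InCone (i, []) (s₁ ^ (m + 1) * ((s₁ ^ (m + 1))⁻¹ * deltaPow i)) := by
      intro i; simpa using inCone_deltaPow i
    have rep : ∀ i, i ≠ 2 → ¬ InCone d'.repelling ((s₁ ^ (m + 1))⁻¹ * deltaPow i) :=
      fun i hi h => h0 ((inCone_s₁_inv_pow_mul hi).comparable h).1.symm
    have := collide (aux 0) (aux 1) (rep 0 (by decide)) (rep 1 (by decide))
    exact absurd this (by decide)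
  -- These columns lie, up to δ^e, in cones indexed by arbitrarily long all-`true` words. A long
  -- form's attracting index contains `false`, so it cannot be a prefix of such a word.
  have hfar : ∀ M : ℕ, InCone d.attracting (delta ^ e * (s₁ ^ (m + 1 + M) * deltaPow 2)) := by
    intro M
    have h := main (s₁ ^ M * deltaPow 2) fun h => by
      have h2 : (2 : Fin 3) = 0 := ((inCone_s₁_pow M).comparable h).1.trans hlast
      exact absurd h2 (by decide)
    rwa [← mul_assoc (s₁ ^ _) (s₁ ^ _), ← pow_add] at h
  cases d with
  | short j =>
    have h := ((inCone_delta_pow_mul e (inCone_s₁_pow _)).comparable (hfar 0)).1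
    rw [add_comm] at h
    rw [add_right_cancel h]
  | long j W =>
    exfalso
    obtain h | h := ((inCone_delta_pow_mul e (inCone_s₁_pow _)).comparable (hfar (W.length + 1))).2
    · have := h.length_le
      simp at this
    · have : false ∈ List.replicate (m + 1 + (W.length + 1)) true := h.subset (by simp)
      simp at this

lemma eq_replicate_of_separated {l : List ConjForm} (hl : l.IsChain Separated) {e k : ℕ}
    (hp : (l.map val).prod = delta ^ e * s₁ ^ k) :
    l = List.replicate k (short (Fin.ofNat 3 e)) := by
  induction l generalizing k with
  | nil =>
    rw [delta_pow_mul_s₁_pow_ne_one hp.symm, List.replicate_zero]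
  | cons d l ih =>
    obtain ⟨rfl, hk⟩ := head_eq_of_prod_eq hl hp
    obtain ⟨m, rfl⟩ := Nat.exists_eq_succ_of_ne_zero hk
    rw [List.replicate_succ, ← ih (k := m) hl.tail]
    rw [List.map_cons, List.prod_cons, val_short_ofNat] at hp
    rw [← mul_right_inj (delta ^ e * s₁ * (delta ^ e)⁻¹), hp, Nat.succ_eq_add_one, pow_succ']
    group

lemma map_val_eq_replicate_of_separated {l : List ConjForm} (hl : l.IsChain Separated) {e k : ℕ}
    (hp : (l.map val).prod = delta ^ e * s₁ ^ k) : l.map val = List.replicate k s₁ := by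
  have h := eq_replicate_of_separated hl hp
  rw [h, List.map_replicate]
  rcases Nat.eq_zero_or_pos k with rfl | hk
  · rfl
  rw [h, List.map_replicate, List.prod_replicate, val_short_ofNat, conj_pow] at hp
  -- For k > 0 all entries equal δ^e s₁ δ^(-e), so the product is also δ^e s₁^k δ^(-e); comparison
  -- gives δ^e = 1.
  have h1 : delta ^ e = 1 := by
    rw [← inv_eq_one]; exact mul_eq_left.1 hp
  rw [val_short_ofNat, h1]
  simp

end ConjForm

/-! ### Hurwitz moves and tuple powers -/

section Hurwitz

variable {G : Type*} [Group G]

lemma ElementaryTransformation.context {l l' : List G} (h : ElementaryTransformation l l')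
    (p q : List G) : ElementaryTransformation (p ++ l ++ q) (p ++ l' ++ q) := by
  cases h with
  | right u v a b => simpa using ElementaryTransformation.right (p ++ u) (v ++ q) a b
  | left u v a b => simpa using ElementaryTransformation.left (p ++ u) (v ++ q) a b

lemma HurwitzEquivalent.context {l l' : List G} (h : HurwitzEquivalent l l') (p q : List G) :
    HurwitzEquivalent (p ++ l ++ q) (p ++ l' ++ q) :=
  Relation.ReflTransGen.lift (r := ElementaryTransformation) (fun l => p ++ l ++ q)
    (fun _ _ h' => ElementaryTransformation.context h' p q) l l' h

lemma HurwitzEquivalent.trans {l₁ l₂ l₃ : List G} (h : HurwitzEquivalent l₁ l₂)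
    (h' : HurwitzEquivalent l₂ l₃) : HurwitzEquivalent l₁ l₃ :=
  Relation.ReflTransGen.trans h h'

lemma HurwitzEquivalent.right (u v : List G) (a b : G) :
    HurwitzEquivalent (u ++ [a, b] ++ v) (u ++ [b, b⁻¹ * a * b] ++ v) :=
  .single (.right u v a b)

lemma HurwitzEquivalent.left (u v : List G) (a b : G) :
    HurwitzEquivalent (u ++ [a, b] ++ v) (u ++ [a * b * a⁻¹, a] ++ v) :=
  .single (.left u v a b)

lemma HurwitzEquivalent.prod_eq {l l' : List G} (h : HurwitzEquivalent l l') :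
    l.prod = l'.prod := by
  induction h with
  | refl => rfl
  | tail _ h ih =>
    rw [ih]
    cases h <;> simp [mul_assoc]

lemma HurwitzEquivalent.length_eq {l l' : List G} (h : HurwitzEquivalent l l') :
    l.length = l'.length := by
  induction h with
  | refl => rfl
  | tail _ h ih =>
    rw [ih]
    cases h <;> simp

/-- An adjacent pair can be moved to the front at the cost of conjugating by its product. -/
lemma HurwitzEquivalent.pair_to_front (u v : List G) (a b : G) :
    HurwitzEquivalent (u ++ [a, b] ++ v)
      ([a, b] ++ (u.map (fun c => (a * b)⁻¹ * c * (a * b)) ++ v)) := by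
  induction u with
  | nil => exact .refl
  | cons c u ih =>
    have h1 := ih.context [c] []
    have h2 := HurwitzEquivalent.right [] ([b] ++ (u.map (fun c => (a * b)⁻¹ * c * (a * b)) ++ v))
      c a
    have h3 := HurwitzEquivalent.right [a] (u.map (fun c => (a * b)⁻¹ * c * (a * b)) ++ v)
      (a⁻¹ * c * a) b
    simp only [List.nil_append, List.cons_append, List.append_nil, List.append_assoc,
      List.map_cons] at h1 h2 h3 ⊢
    have h4 : b⁻¹ * (a⁻¹ * c * a) * b = (a * b)⁻¹ * c * (a * b) := by group
    rw [h4] at h3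
    exact (h1.trans h2).trans h3

end Hurwitz

lemma tuplePow_succ {G : Type*} (a : List G) (m : ℕ) :
    tuplePow a (m + 1) = a ++ tuplePow a m := by
  simp [tuplePow, List.replicate_succ]

lemma tuplePow_singleton {G : Type*} (a : G) (m : ℕ) : tuplePow [a] m = List.replicate m a := by
  induction m with
  | zero => rfl
  | succ m ih => rw [tuplePow_succ, ih, List.replicate_succ, List.singleton_append]

lemma length_tuplePow {G : Type*} (a : List G) (m : ℕ) :
    (tuplePow a m).length = m * a.length := by
  simp [tuplePow]

lemma prod_tuplePow {G : Type*} [Group G] (a : List G) (m : ℕ) :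
    (tuplePow a m).prod = a.prod ^ m := by
  simp [tuplePow, List.prod_flatten]

/-! ### Reduction to the normal form -/

namespace ConjForm

lemma val_short_mul (j : Fin 3) : (short j).val * (short (j + 1)).val = delta := by
  revert j; decide

/-- Each left move lowers the index by one, so the three factorizations of δ are cyclically
connected. -/
lemma hurwitzEquivalent_short_pair (j : Fin 3) :
    HurwitzEquivalent [(short j).val, (short (j + 1)).val] [s₁, s₂] := by
  have step : ∀ j : Fin 3, HurwitzEquivalent [(short (j + 1)).val, (short (j + 2)).val]
      [(short j).val, (short (j + 1)).val] := by
    intro j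
    have h := HurwitzEquivalent.left [] [] (short (j + 1)).val (short (j + 2)).val
    have hj : (short (j + 1)).val * (short (j + 2)).val * (short (j + 1)).val⁻¹
        = (short j).val := by clear h; revert j; decide
    rwa [hj] at h
  have h0 : HurwitzEquivalent [(short 0).val, (short 1).val] [s₁, s₂] := by
    have h1 : (short 0).val = s₁ := by decide
    have h2 : (short 1).val = s₂ := by decide
    rw [h1, h2]
    exact .refl
  have h1 := (step 0).trans h0
  have h2 := (step 1).trans h1
  fin_cases j
  · exact h0
  · exact h1
  · exact h2

lemma val_rotate_rotate (d : ConjForm) : d.rotate.rotate.val = delta⁻¹ * d.val * delta := by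
  have h : delta * delta = -delta⁻¹ := by decide
  have h' : delta * (delta * d.val * delta⁻¹) * delta⁻¹
      = (delta * delta) * d.val * (delta * delta)⁻¹ := by group
  rw [val_rotate, val_rotate, h', h]
  simp [inv_neg]

lemma exists_eq_append_of_not_isChain {l : List ConjForm} (h : ¬ l.IsChain Separated) :
    ∃ u d d' v, l = u ++ [d, d'] ++ v ∧ ¬ Separated d d' := by
  rw [List.isChain_iff_forall_rel_of_append_cons_cons] at h
  push Not at h
  obtain ⟨d, d', u, v, rfl, hd⟩ := h
  exact ⟨u, d, d', v, by simp, hd⟩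

/-- A tuple of conjugates of `s₁` with product `δ^e s₁^k` is Hurwitz equivalent to
`(s₁, s₂)^m (s₁)^k` for some `m`. -/
theorem exists_hurwitzEquivalent (l : List ConjForm) (e k : ℕ)
    (hp : (l.map val).prod = delta ^ e * s₁ ^ k) :
    ∃ m, HurwitzEquivalent (l.map val) (tuplePow [s₁, s₂] m ++ tuplePow [s₁] k) := by
  induction hn : l.length using Nat.strong_induction_on generalizing l e with
  | _ n ihn =>
  induction hD : (l.map depth).sum using Nat.strong_induction_on generalizing l with
  | _ D ihD =>
  by_cases hl : l.IsChain Separated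
  · refine ⟨0, ?_⟩
    rw [map_val_eq_replicate_of_separated hl hp, tuplePow_singleton]
    exact .refl
  obtain ⟨u, d, d', v, rfl, hd⟩ := exists_eq_append_of_not_isChain hl
  have step : ∀ c c' : ConjForm, c.depth + c'.depth < d.depth + d'.depth →
      HurwitzEquivalent ((u ++ [d, d'] ++ v).map val) ((u ++ [c, c'] ++ v).map val) →
      ∃ m, HurwitzEquivalent ((u ++ [d, d'] ++ v).map val)
        (tuplePow [s₁, s₂] m ++ tuplePow [s₁] k) := by
    intro c c' hc h
    obtain ⟨m, hm⟩ := ihD _ (by rw [← hD]; simp; lia) (u ++ [c, c'] ++ v)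
      (by rw [← h.prod_eq, hp]) (by rw [← hn]; simp) rfl
    exact ⟨m, h.trans hm⟩
  rcases reduce_of_not_separated hd with ⟨j, rfl, rfl⟩ | ⟨c, hc, hlt⟩ | ⟨c, hc, hlt⟩
  · have h := HurwitzEquivalent.pair_to_front (u.map val) (v.map val) (short j).val
      (short (j + 1)).val
    rw [val_short_mul] at h
    have hrest : (u.map val).map (fun c => delta⁻¹ * c * delta) ++ v.map val
        = (u.map (fun d => d.rotate.rotate) ++ v).map val := by
      simp [val_rotate_rotate, Function.comp_def]
    rw [hrest] at h
    have hmap : (u ++ [short j, short (j + 1)] ++ v).map val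
        = u.map val ++ [(short j).val, (short (j + 1)).val] ++ v.map val := by simp
    rw [hmap] at hp ⊢
    -- Splitting off a pair multiplies the remaining product by δ⁻¹ = δ⁵, which keeps the exponent
    -- natural.
    obtain ⟨m, hm⟩ := ihn _ (by rw [← hn]; simp)
      (u.map (fun d => d.rotate.rotate) ++ v) (5 + e) (by
        have h5 : delta ^ 5 = delta⁻¹ := by decide
        have hp' := h.prod_eq
        rw [hp, List.prod_append, List.prod_pair, val_short_mul] at hp'
        rw [pow_add, h5, mul_assoc, hp', inv_mul_cancel_left]) rfl
    refine ⟨m + 1, h.trans ?_⟩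
    rw [tuplePow_succ]
    have h1 := (hurwitzEquivalent_short_pair j).context []
      ((u.map (fun d => d.rotate.rotate) ++ v).map val)
    have h2 := hm.context [s₁, s₂] []
    simp only [List.nil_append, List.append_nil, List.append_assoc] at h1 h2 ⊢
    exact h1.trans h2
  · refine step c d (by lia) ?_
    have h := HurwitzEquivalent.left (u.map val) (v.map val) d.val d'.val
    rw [← hc] at h
    simpa using h
  · refine step d' c (by lia) ?_
    have h := HurwitzEquivalent.right (u.map val) (v.map val) d.val d'.val
    rw [← hc] at h
    simpa using h

end ConjForm

lemma mod_six_eq_of_delta_pow_eq {m r : ℕ} (hr : r < 6) (h : delta ^ m = delta ^ r) :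
    m % 6 = r := by
  rw [← Nat.div_add_mod m 6, pow_add, pow_mul, delta_pow_six, one_pow, one_mul] at h
  have hm : m % 6 < 6 := Nat.mod_lt _ (by norm_num)
  generalize m % 6 = q at h hm
  revert h
  interval_cases q <;> interval_cases r <;> decide

/-- The number of pairs in the normal form is determined modulo six by the product. -/
lemma exists_normal_form {k n r : ℕ} {g : Fin n → SL(2, ℤ)} (hg : ∀ i, IsConj s₁ (g i))
    (hr : r < 6) (hp : (List.ofFn g).prod = delta ^ r * s₁ ^ k) :
    ∃ p : ℕ, n = 2 * (6 * p + r) + k ∧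
      HurwitzEquivalent (List.ofFn g) (tuplePow [s₁, s₂] (6 * p + r) ++ tuplePow [s₁] k) := by
  choose d hd using fun i => ConjForm.exists_of_isConj (hg i)
  obtain rfl : (fun i => (d i).val) = g := funext hd
  have hmap : List.ofFn (fun i => (d i).val) = (List.ofFn d).map ConjForm.val := by
    rw [List.map_ofFn]; rfl
  rw [hmap] at hp ⊢
  obtain ⟨m, hm⟩ := ConjForm.exists_hurwitzEquivalent _ _ _ hp
  have hprod := hm.prod_eq
  rw [hp, List.prod_append, prod_tuplePow, prod_tuplePow, List.prod_pair, List.prod_singleton,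
    mul_left_inj] at hprod
  have hmod : m % 6 = r := mod_six_eq_of_delta_pow_eq hr hprod.symm
  have hlen := hm.length_eq
  simp only [List.length_map, List.length_ofFn, List.length_append, length_tuplePow,
    List.length_cons, List.length_nil] at hlen
  have hdiv : 6 * (m / 6) + r = m := by lia
  exact ⟨m / 6, by lia, by rwa [hdiv]⟩

theorem theorem2p3 (k n : ℕ) (g : Fin n → SL(2, ℤ)) (hg : ∀ i, IsConj s₁ (g i)) :
    ((List.ofFn g).prod = s₁ ^ k →
      ∃ p : ℕ, (n : ℤ) - k = 12 * p ∧
        HurwitzEquivalent (List.ofFn g)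
          (tuplePow [s₁, s₂] (6 * p) ++ tuplePow [s₁] k)) ∧
    ((List.ofFn g).prod = (s₁ * s₂) ^ 3 * s₁ ^ k →
      ∃ p : ℕ, (n : ℤ) - 6 - k = 12 * p ∧
        HurwitzEquivalent (List.ofFn g)
          (tuplePow [s₁, s₂] (6 * p + 3) ++ tuplePow [s₁] k)) := by
  refine ⟨fun h => ?_, fun h => ?_⟩
  · obtain ⟨p, hn, hp⟩ := exists_normal_form (r := 0) hg (by norm_num) (by simpa using h)
    exact ⟨p, by lia, hp⟩
  · obtain ⟨p, hn, hp⟩ := exists_normal_form (r := 3) hg (by norm_num) h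
    exact ⟨p, by lia, hp⟩
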